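/- Let $\Omega\subset\mathbf C$ be open and connected, and let $V:\Omega\to[-\infty,\infty)$ be subharmonic (upper semicontinuous, not identically $-\infty$, satisfying the sub-mean-value inequality on circles bounding closed disks contained in $\Omega$). Suppose that $K=\operatorname{supp}(\Delta V)$, the support in $\Omega$ of the distributional Laplacian of $V$, has Lebesgue measure $0$ (that is, $V\in\mathrm{SH}_0(\Omega)$). Assume that $\Omega\setminus K=U\cup W$ with $U,W$ disjoint open sets, that $V=0$ on $U$, and that $\operatorname{Re}(\partial V/\partial z)<0$ on $W$, where $\partial V/\partial z=\tfrac12(\partial V/\partial x-i\,\partial V/\partial y)$ (off $K$ the function $V$ is harmonic, so this is a holomorphic function there). For $\zeta\in\Omega$ let $\rho^*(\zeta)\in(0,\infty]$ be the largest $a$ such that $\zeta+t\in\Omega$ for all real $0<t<a$. Then $U$ equals its forward star domain, $$U=\mathfrak s^{\uparrow}(U):=\{z\in\Omega:\ z=\zeta+t\ \text{for some}\ \zeta\in U\ \text{and}\ 0\le t<\rho^*(\zeta)\}.$$ -/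

import Mathlib

open MeasureTheory Set TopologicalSpace
open scoped Distributions LineDeriv ENNReal

noncomputable section

/-- The mean value `(1 / 2π) ∫₀^{2π} V (z + r e^{iθ}) dθ` of an extended-real-valued function over
the circle of centre `z` and radius `r`, as the mean of the positive part minus the mean of the
negative part. When `V` is upper semicontinuous and `< ⊤` on the circle, the first mean is finite,
so the value is a well-defined element of `[-∞, ∞)`. -/
def circleMean (V : ℂ → EReal) (z : ℂ) (r : ℝ) : EReal :=
  ((ENNReal.ofReal (2 * Real.pi)⁻¹ *
      ∫⁻ θ in Ioc 0 (2 * Real.pi), (V (circleMap z r θ)).toENNReal : ℝ≥0∞) : EReal) -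
    ((ENNReal.ofReal (2 * Real.pi)⁻¹ *
      ∫⁻ θ in Ioc 0 (2 * Real.pi), (-V (circleMap z r θ)).toENNReal : ℝ≥0∞) : EReal)

/-- `V` is subharmonic in the open connected set `Ω`: it is upper semicontinuous with values in
`[-∞, ∞)`, not identically `-∞`, and satisfies the sub-mean-value inequality on every closed disk
contained in `Ω`. Only the values of `V` in `Ω` matter. -/
structure IsSubharmonicOn (V : ℂ → EReal) (Ω : Opens ℂ) : Prop where
  upperSemicontinuousOn : UpperSemicontinuousOn V (Ω : Set ℂ)
  lt_top : ∀ z ∈ Ω, V z < ⊤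
  exists_ne_bot : ∃ z ∈ Ω, V z ≠ ⊥
  le_circleMean : ∀ (z : ℂ) (r : ℝ), 0 < r → Metric.closedBall z r ⊆ (Ω : Set ℂ) →
    V z ≤ circleMean V z r

/-- The distribution `φ ↦ ∫ φ V dx dy` in `Ω` defined by `V`. A subharmonic function is locally
integrable and is `-∞` only on a null set, where the real number `(V z).toReal` is `0`. -/
def toDistribution (V : ℂ → EReal) (Ω : Opens ℂ) : 𝓓'(Ω, ℝ) :=
  (TestFunction.integralAgainstBilinCLM (ContinuousLinearMap.mul ℝ ℝ) volume
    (fun z => (V z).toReal) : 𝓓(Ω, ℝ) →L[ℝ] ℝ)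

/-- The Laplacian `ΔV = ∂²V/∂x² + ∂²V/∂y²` in `Ω` in the sense of distributions. -/
def distLaplacian (V : ℂ → EReal) (Ω : Opens ℂ) : 𝓓'(Ω, ℝ) :=
  let T : 𝓓'(Ω, ℝ) := toDistribution V Ω
  let Tx : 𝓓'(Ω, ℝ) := ∂_{(1 : ℂ)} T
  let Ty : 𝓓'(Ω, ℝ) := ∂_{Complex.I} T
  ∂_{(1 : ℂ)} Tx + ∂_{Complex.I} Ty

/-- The support of the distribution `ΔV` in `Ω`: a relatively closed subset of `Ω`, whose
complement in `Ω` is the largest open subset of `Ω` on which `ΔV` vanishes. -/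
def laplacianSupport (V : ℂ → EReal) (Ω : Opens ℂ) : Set ℂ :=
  Distribution.dsupport (distLaplacian V Ω) ∩ (Ω : Set ℂ)

/-- `V ∈ SH₀(Ω)`: `V` is subharmonic in `Ω` and the support of the distribution `ΔV` is a Lebesgue
null set. -/
structure MemSH0 (V : ℂ → EReal) (Ω : Opens ℂ) : Prop where
  isSubharmonicOn : IsSubharmonicOn V Ω
  volume_laplacianSupport : volume (laplacianSupport V Ω) = 0

/-- The derivative `∂V/∂z = (1/2) (∂V/∂x - i ∂V/∂y)`. It is used off the support of `ΔV`, where a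
subharmonic `V` is a (real-valued, smooth) harmonic function, so that the distribution derivative
is the holomorphic function given by the classical derivative. -/
def dz (V : ℂ → EReal) (z : ℂ) : ℂ :=
  (1 / 2 : ℂ) * (((fderiv ℝ (fun w => (V w).toReal) z 1 : ℝ) : ℂ) -
    Complex.I * ((fderiv ℝ (fun w => (V w).toReal) z Complex.I : ℝ) : ℂ))

/-- `ρ*(z)`, the largest `a ∈ (0, ∞]` such that `z + t ∈ Ω` for all real `0 < t < a`. -/
def forwardReach (Ω : Set ℂ) (z : ℂ) : EReal :=
  sSup {a : EReal | 0 < a ∧ ∀ t : ℝ, 0 < t → (t : EReal) < a → z + (t : ℂ) ∈ Ω}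

/-- The forward star domain `𝔰↑(U)` of `U` in `Ω`. -/
def forwardStarDomain (Ω U : Set ℂ) : Set ℂ :=
  {z | z ∈ Ω ∧ ∃ ζ ∈ U, ∃ t : ℝ, 0 ≤ t ∧ (t : EReal) < forwardReach Ω ζ ∧ z = ζ + (t : ℂ)}

end

section

open Metric Filter Topology

/-! It suffices to show that if a horizontal segment in `U` ends at `p ∈ Ω`, then `p ∈ U`; applied
at the first exit point of a ray, this is a contradiction (`mem_of_segment_subset`).

Let `f` be the positive part of `V` in a disk about `p`. Off the null set `K`, `f` does not increase
to the right: it is `0` on `U`, and `V` decreases on `W`. This must persist across `K`. A null set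
alone is no obstacle because `f` is bounded and subharmonic, so its gradient is locally square
integrable and `∂f/∂x` has no part concentrated on `K`. A quantitative form of this is
`fderiv_mollify_one_nonpos`: mollifications of `f` have nonpositive `x`-derivative.

Mollified at a small scale, `f` vanishes at a point `p - s` of `U`, hence also at `p`. So `V ≤ 0`
near `p`, while `V p = 0` by upper semicontinuity along the segment. The maximum principle gives `V
= 0` almost everywhere near `p`, so `p` is outside the support of the Laplacian; being a limit of
points of `U`, it is not in `W`. -/

/-! ### Taylor bounds and moments of the unit disk -/

theorem exists_taylor_bound {g : ℂ → ℝ} (hg : ContDiff ℝ 2 g) (hgc : HasCompactSupport g) :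
    ∃ L : ℝ, 0 ≤ L ∧ ∀ z h : ℂ, |g (z + h) - g z - fderiv ℝ g z h| ≤ L * ‖h‖ ^ 2 := by
  have h1 : ContDiff ℝ 1 (fderiv ℝ g) := hg.fderiv_right (by norm_num)
  obtain ⟨C, hC⟩ := ContDiff.lipschitzWith_of_hasCompactSupport (hgc.fderiv (𝕜 := ℝ)) h1 (by simp)
  refine ⟨C, C.2, fun z h => ?_⟩
  have := (convex_closedBall z ‖h‖).norm_image_sub_le_of_norm_fderiv_le' (𝕜 := ℝ) (f := g)
    (φ := fderiv ℝ g z) (C := C * ‖h‖) (x := z) (y := z + h)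
    (fun x _ => (hg.differentiable (by norm_num)).differentiableAt)
    (fun x hx => by
      have := hC.dist_le_mul x z
      rw [dist_eq_norm] at this
      exact this.trans (mul_le_mul_of_nonneg_left (mem_closedBall.1 hx) C.2))
    (mem_closedBall_self (norm_nonneg _)) (by simp)
  simpa [pow_two, mul_assoc] using this

theorem setIntegral_ball_eq_zero_of_odd (k : ℂ → ℝ) (hk : ∀ u, k (-u) = -k u) (r : ℝ) :
    ∫ u in ball (0 : ℂ) r, k u = 0 := by
  have h : ∫ u in ball (0 : ℂ) r, k u = ∫ u in ball (0 : ℂ) r, k (-u) := by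
    rw [← (Measure.measurePreserving_neg (volume : Measure ℂ)).setIntegral_preimage_emb
      (MeasurableEquiv.neg ℂ).measurableEmbedding k (ball 0 r)]
    simp
  simp_rw [hk, integral_neg] at h
  linarith

theorem setIntegral_ball_comp_conj (k : ℂ → ℝ) (r : ℝ) :
    ∫ u in ball (0 : ℂ) r, k (-(starRingEnd ℂ u)) = ∫ u in ball (0 : ℂ) r, k u := by
  have e : MeasurePreserving (fun u : ℂ => -(starRingEnd ℂ u)) volume volume :=
    (Measure.measurePreserving_neg (volume : Measure ℂ)).comp
      (Complex.conjLIE.measurePreserving)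
  have e2 : MeasurableEmbedding (fun u : ℂ => -(starRingEnd ℂ u)) :=
    (MeasurableEquiv.neg ℂ).measurableEmbedding.comp
      Complex.conjLIE.toHomeomorph.measurableEmbedding
  rw [← e.setIntegral_preimage_emb e2 k (ball 0 r)]
  congr 2
  ext u
  simp

theorem volume_real_unit_ball : volume.real (ball (0 : ℂ) 1) = Real.pi := by
  simp [Measure.real, Complex.volume_ball]

/-- The mixed moment of `u.re * u.im` vanishes by reflection in the imaginary axis. The weight
`u.re` thus extracts `∂/∂x` from disk averages of a linearized function. -/
theorem exists_setIntegral_re_mul_clm :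
    ∃ c : ℝ, 0 < c ∧ ∀ l : ℂ →L[ℝ] ℝ, ∫ u in ball (0 : ℂ) 1, u.re * l u = c * l 1 := by
  have hI : ∀ k : ℂ → ℝ, Continuous k → IntegrableOn k (ball (0 : ℂ) 1) := fun k hk =>
    (hk.continuousOn.integrableOn_compact (isCompact_closedBall 0 1)).mono_set
      ball_subset_closedBall
  refine ⟨∫ u in ball (0 : ℂ) 1, u.re * u.re, ?_, fun l => ?_⟩
  · rw [setIntegral_pos_iff_support_of_nonneg_ae (ae_of_all _ fun u => mul_self_nonneg _)
      (hI _ (by fun_prop))]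
    refine IsOpen.measure_pos _ (IsOpen.inter ?_ isOpen_ball) ⟨1 / 2, ?_, ?_⟩
    · exact (Continuous.mul Complex.continuous_re Complex.continuous_re).isOpen_support
    · simp
    · simp; norm_num
  · have hl : ∀ u : ℂ, u.re * l u = l 1 * (u.re * u.re) + l Complex.I * (u.re * u.im) := by
      intro u
      have : u = u.re • (1 : ℂ) + u.im • Complex.I := by
        simp
      conv_lhs => rw [this, map_add, map_smul, map_smul]
      simp
      ring
    have h0 : ∫ u in ball (0 : ℂ) 1, u.re * u.im = 0 := by
      have := setIntegral_ball_comp_conj (fun u => u.re * u.im) 1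
      simp [integral_neg] at this
      linarith
    simp_rw [hl]
    rw [integral_add ((hI _ (by fun_prop)).const_mul _) ((hI _ (by fun_prop)).const_mul _),
      integral_const_mul, integral_const_mul, h0]
    ring

/-! ### Mollification and disk averages -/

/-- The convolution of `f` and `φ`. -/
noncomputable def mollify (f φ : ℂ → ℝ) (z : ℂ) : ℝ := ∫ w, f w * φ (z - w)

theorem integrable_of_bounded_of_hasCompactSupport {f : ℂ → ℝ} {M : ℝ} (hfm : Measurable f)
    (hfM : ∀ w, |f w| ≤ M) (hfc : HasCompactSupport f) : Integrable f := by
  rw [← integrableOn_iff_integrable_of_support_subset (subset_tsupport f)]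
  exact Measure.integrableOn_of_bounded (M := M) hfc.measure_lt_top.ne hfm.aestronglyMeasurable
    (ae_of_all _ hfM)

theorem mollify_eq_convolution (f φ : ℂ → ℝ) :
    mollify f φ = convolution f φ (ContinuousLinearMap.mul ℝ ℝ) volume := by
  ext z
  simp [mollify, convolution_def]

theorem contDiff_mollify {f φ : ℂ → ℝ} {n : ℕ∞} (hf : Integrable f) (hφ : ContDiff ℝ n φ)
    (hφc : HasCompactSupport φ) : ContDiff ℝ n (mollify f φ) := by
  rw [mollify_eq_convolution]
  apply HasCompactSupport.contDiff_convolution_right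
  · exact hφc
  · exact hf.locallyIntegrable
  · exact hφ

theorem hasCompactSupport_mollify {f φ : ℂ → ℝ} (hfc : HasCompactSupport f)
    (hφc : HasCompactSupport φ) : HasCompactSupport (mollify f φ) := by
  rw [mollify_eq_convolution]
  exact hfc.convolution (ContinuousLinearMap.mul ℝ ℝ) hφc

theorem mollify_add (f φ : ℂ → ℝ) (z h : ℂ) :
    mollify f φ (z + h) = ∫ w, f (w + h) * φ (z - w) := by
  rw [mollify, ← integral_add_right_eq_self _ h]
  simp

theorem integrable_mul_mul_comp_sub {f φ k : ℂ → ℝ} {M : ℝ} (hfm : Measurable f)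
    (hfM : ∀ w, |f w| ≤ M) (hφ : Continuous φ) (hφc : HasCompactSupport φ)
    (hk : Measurable k) (hk1 : ∀ u ∈ ball (0 : ℂ) 1, |k u| ≤ 1) (z : ℂ) (r : ℝ) :
    Integrable (Function.uncurry fun u w : ℂ => k u * (f (w + r * u) * φ (z - w)))
      ((volume.restrict (ball 0 1)).prod volume) := by
  have h1 : Integrable (fun w : ℂ => M * |φ (z - w)|) :=
    (((hφ.integrable_of_hasCompactSupport hφc).comp_sub_left z).abs).const_mul M
  have : IsFiniteMeasure ((volume : Measure ℂ).restrict (ball 0 1)) :=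
    ⟨by simp⟩
  have h2 := (integrable_const (μ := (volume : Measure ℂ).restrict (ball 0 1)) (1 : ℝ)).mul_prod h1
  refine h2.mono' (Measurable.aestronglyMeasurable (by
    have := hφ.measurable
    unfold Function.uncurry
    fun_prop)) ?_
  filter_upwards [Measure.quasiMeasurePreserving_fst.ae
    (ae_restrict_mem (μ := (volume : Measure ℂ)) (measurableSet_ball (x := (0 : ℂ)) (ε := 1)))]
    with p hp
  have hM : 0 ≤ M := (abs_nonneg _).trans (hfM 0)
  simp only [Function.uncurry, norm_mul, Real.norm_eq_abs, one_mul]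
  have a := hk1 p.1 hp
  calc |k p.1| * (|f (p.2 + r * p.1)| * |φ (z - p.2)|) ≤ 1 * (M * |φ (z - p.2)|) := by
        gcongr
        exact hfM _
    _ = _ := one_mul _

/-- Fubini: pointwise estimates for disk averages of `f` pass to its mollification. The weights
needed are `u.re` and `1`. -/
theorem setIntegral_mul_mollify {f φ k : ℂ → ℝ} {M : ℝ} (hfm : Measurable f)
    (hfM : ∀ w, |f w| ≤ M) (hφ : Continuous φ) (hφc : HasCompactSupport φ)
    (hk : Measurable k) (hk1 : ∀ u ∈ ball (0 : ℂ) 1, |k u| ≤ 1) (z : ℂ) (r : ℝ) :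
    Integrable (fun w => φ (z - w) * ∫ u in ball (0 : ℂ) 1, k u * f (w + r * u)) ∧
    ∫ u in ball (0 : ℂ) 1, k u * mollify f φ (z + r * u) =
      ∫ w, φ (z - w) * ∫ u in ball (0 : ℂ) 1, k u * f (w + r * u) := by
  have hI := integrable_mul_mul_comp_sub hfm hfM hφ hφc hk hk1 z r
  have e : ∀ w, φ (z - w) * ∫ u in ball (0 : ℂ) 1, k u * f (w + r * u) =
      ∫ u in ball (0 : ℂ) 1, k u * (f (w + r * u) * φ (z - w)) := fun w => by
    rw [← integral_const_mul]
    congr 1; ext u; ring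
  constructor
  · simp_rw [e]
    exact hI.integral_prod_right
  · simp_rw [mollify_add, e, ← integral_const_mul]
    exact integral_integral_swap hI

theorem integrable_comp_add_mul {f : ℂ → ℝ} {M : ℝ} (hfm : Measurable f)
    (hfM : ∀ w, |f w| ≤ M) (w : ℂ) (r : ℝ) :
    IntegrableOn (fun u : ℂ => f (w + r * u)) (ball 0 1) :=
  Measure.integrableOn_of_bounded (M := M) measure_ball_lt_top.ne
    (by fun_prop : Measurable _).aestronglyMeasurable (ae_of_all _ fun _ => hfM _)

/-! ### Horizontal derivative of a mollification across a null set -/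

/-- The mean square oscillation of a nonnegative function with the sub-mean-value property is
controlled by the defect of its square. -/
theorem setIntegral_sq_sub_le {f : ℂ → ℝ} {M : ℝ} (hfm : Measurable f) (hf0 : ∀ w, 0 ≤ f w)
    (hfM : ∀ w, f w ≤ M) {w : ℂ} {r : ℝ}
    (sub : Real.pi * f w ≤ ∫ u in ball (0 : ℂ) 1, f (w + r * u)) :
    IntegrableOn (fun u : ℂ => (f (w + r * u) - f w) ^ 2) (ball 0 1) ∧
    ∫ u in ball (0 : ℂ) 1, (f (w + r * u) - f w) ^ 2 ≤
      (∫ u in ball (0 : ℂ) 1, f (w + r * u) ^ 2) - Real.pi * f w ^ 2 := by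
  have hfM' : ∀ w, |f w| ≤ M := fun w => by rw [abs_of_nonneg (hf0 w)]; exact hfM w
  have i1 := integrable_comp_add_mul hfm hfM' w r
  have i2 : IntegrableOn (fun u : ℂ => f (w + r * u) ^ 2) (ball 0 1) :=
    integrable_comp_add_mul (M := M ^ 2) (hfm.pow_const 2)
      (fun w => by rw [abs_pow]; gcongr; exact hfM' w) w r
  have i3 : IntegrableOn (fun _ : ℂ => f w ^ 2) (ball (0 : ℂ) 1) :=
    integrableOn_const measure_ball_lt_top.ne
  have e : ∀ u : ℂ, (f (w + r * u) - f w) ^ 2 =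
      f (w + r * u) ^ 2 - 2 * f w * f (w + r * u) + f w ^ 2 := fun u => by ring
  simp_rw [e]
  have i4 : IntegrableOn (fun u : ℂ => f (w + r * u) ^ 2 - 2 * f w * f (w + r * u)) (ball 0 1) :=
    i2.sub (i1.const_mul (2 * f w))
  refine ⟨i4.add i3, ?_⟩
  rw [integral_add i4 i3, integral_sub i2 (i1.const_mul (2 * f w)), integral_const_mul,
    setIntegral_const, volume_real_unit_ball, smul_eq_mul]
  nlinarith [mul_le_mul_of_nonneg_left sub (hf0 w)]

/-- Since `u.re` has mean zero, `f w` may be subtracted from `f (w + r * u)`; the AM-GM inequality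
then brings in the mean square oscillation. This is the bound used near `K`, where monotonicity is
unavailable. -/
theorem setIntegral_re_mul_le {f : ℂ → ℝ} {M : ℝ} (hfm : Measurable f) (hf0 : ∀ w, 0 ≤ f w)
    (hfM : ∀ w, f w ≤ M) {w : ℂ} {r ε : ℝ} (hr : 0 < r) (hε : 0 < ε)
    (sub : Real.pi * f w ≤ ∫ u in ball (0 : ℂ) 1, f (w + r * u)) :
    ∫ u in ball (0 : ℂ) 1, u.re * f (w + r * u) ≤ Real.pi * r / (2 * ε) +
      ε / (2 * r) * ((∫ u in ball (0 : ℂ) 1, f (w + r * u) ^ 2) - Real.pi * f w ^ 2) := by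
  have hfM' : ∀ w, |f w| ≤ M := fun w => by rw [abs_of_nonneg (hf0 w)]; exact hfM w
  obtain ⟨i2, h2⟩ := setIntegral_sq_sub_le hfm hf0 hfM sub
  have hre : ∀ u ∈ ball (0 : ℂ) 1, |u.re| ≤ 1 := fun u hu =>
    (Complex.abs_re_le_norm u).trans (by simpa using (mem_ball_zero_iff.1 hu).le)
  have hre1 : ∫ u in ball (0 : ℂ) 1, u.re = 0 :=
    setIntegral_ball_eq_zero_of_odd _ (fun u => by simp) 1
  have ire : IntegrableOn (fun u : ℂ => u.re) (ball (0 : ℂ) 1) :=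
    Measure.integrableOn_of_bounded (M := 1) measure_ball_lt_top.ne
      Complex.measurable_re.aestronglyMeasurable
      ((ae_restrict_iff' measurableSet_ball).2 (ae_of_all _ hre))
  have i1 : IntegrableOn (fun u : ℂ => u.re * f (w + r * u)) (ball (0 : ℂ) 1) :=
    Measure.integrableOn_of_bounded (M := 1 * M) measure_ball_lt_top.ne
      (by have := Complex.measurable_re; fun_prop : Measurable _).aestronglyMeasurable
      ((ae_restrict_iff' measurableSet_ball).2 (ae_of_all _ fun u hu => by
        rw [Real.norm_eq_abs, abs_mul]
        exact mul_le_mul (hre u hu) (hfM' _) (abs_nonneg _) zero_le_one))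
  have i3 : IntegrableOn (fun _ : ℂ => r / (2 * ε)) (ball (0 : ℂ) 1) :=
    integrableOn_const measure_ball_lt_top.ne
  have e : ∫ u in ball (0 : ℂ) 1, u.re * f (w + r * u) =
      ∫ u in ball (0 : ℂ) 1, (u.re * f (w + r * u) - u.re * f w) := by
    rw [integral_sub i1 (ire.mul_const _), integral_mul_const, hre1]
    simp
  calc _ ≤ ∫ u in ball (0 : ℂ) 1, (r / (2 * ε) + ε / (2 * r) * (f (w + r * u) - f w) ^ 2) := by
        rw [e]
        refine setIntegral_mono_on (i1.sub (ire.mul_const _)) (i3.add (i2.const_mul _))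
          measurableSet_ball fun u hu => ?_
        rw [← mul_sub]
        set d := f (w + r * u) - f w
        have h3 : u.re * d ≤ |d| := by
          refine (le_abs_self _).trans ?_
          rw [abs_mul]
          exact mul_le_of_le_one_left (abs_nonneg _) (hre u hu)
        have h4 : |d| ≤ r / (2 * ε) + ε / (2 * r) * d ^ 2 := by
          have : r / (2 * ε) + ε / (2 * r) * d ^ 2 - |d| = (r - ε * |d|) ^ 2 / (2 * ε * r) := by
            rw [← sq_abs d]
            field_simp
            ring
          have : 0 ≤ (r - ε * |d|) ^ 2 / (2 * ε * r) := by positivity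
          linarith
        exact h3.trans h4
    _ ≤ _ := by
        rw [integral_add i3 (i2.const_mul _), setIntegral_const, integral_const_mul,
          volume_real_unit_ball, smul_eq_mul, mul_div_assoc]
        gcongr

/-- The `u.re`-weighted disk average of the mollification is about `c * r` times its `x`-derivative.
At centres farther than `r` from `K` the average of `f` is nonpositive. Nearer centres contribute at
most a multiple of `r / ε` times the area of `thickening r K`, plus `ε / r` times the mollified
defect of `f ^ 2`, which is `O(r ^ 2)`. Divide by `r`, then let `r → 0` and `ε → 0`. -/
theorem fderiv_mollify_one_nonpos {f φ : ℂ → ℝ} {K : Set ℂ} {M δ : ℝ} {z : ℂ}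
    (hfm : Measurable f) (hf0 : ∀ w, 0 ≤ f w) (hfM : ∀ w, f w ≤ M) (hfc : HasCompactSupport f)
    (hφ : ContDiff ℝ 2 φ) (hφc : HasCompactSupport φ) (hφ0 : ∀ w, 0 ≤ φ w)
    (hK : IsCompact K) (hK0 : volume K = 0) (hδ : 0 < δ)
    (sub : ∀ w, φ (z - w) ≠ 0 → ∀ r : ℝ, 0 < r → r < δ →
      Real.pi * f w ≤ ∫ u in ball (0 : ℂ) 1, f (w + r * u))
    (mono : ∀ w, φ (z - w) ≠ 0 → ∀ r : ℝ, 0 < r → r < δ → Disjoint (ball w r) K →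
      ∫ u in ball (0 : ℂ) 1, u.re * f (w + r * u) ≤ 0) :
    fderiv ℝ (mollify f φ) z 1 ≤ 0 := by
  have hM : 0 ≤ M := (hf0 0).trans (hfM 0)
  have hfM' : ∀ w, |f w| ≤ M := fun w => by rw [abs_of_nonneg (hf0 w)]; exact hfM w
  set f2 : ℂ → ℝ := fun w => f w ^ 2
  have hf2m : Measurable f2 := hfm.pow_const 2
  have hf2M : ∀ w, |f2 w| ≤ M ^ 2 := fun w => by
    simp only [f2, abs_pow]; gcongr; exact hfM' w
  have hf2c : HasCompactSupport f2 := hfc.comp_left (g := fun x => x ^ 2) (by simp)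
  have hφ' : ContDiff ℝ ((2 : ℕ∞) : WithTop ℕ∞) φ := by exact_mod_cast hφ
  have hg : ContDiff ℝ 2 (mollify f φ) := by
    exact_mod_cast contDiff_mollify (integrable_of_bounded_of_hasCompactSupport hfm hfM' hfc)
      hφ' hφc
  have hg2 : ContDiff ℝ 2 (mollify f2 φ) := by
    exact_mod_cast contDiff_mollify (integrable_of_bounded_of_hasCompactSupport hf2m hf2M hf2c)
      hφ' hφc
  obtain ⟨L1, hL1, T1⟩ := exists_taylor_bound hg (hasCompactSupport_mollify hfc hφc)
  obtain ⟨L2, hL2, T2⟩ := exists_taylor_bound hg2 (hasCompactSupport_mollify hf2c hφc)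
  obtain ⟨c, hc, hcl⟩ := exists_setIntegral_re_mul_clm
  obtain ⟨Φ, hΦ⟩ := hφ.continuous.bounded_above_of_compact_support hφc
  have hΦ0 : 0 ≤ Φ := (norm_nonneg _).trans (hΦ 0)
  have hI : ∀ k : ℂ → ℝ, Continuous k → IntegrableOn k (ball (0 : ℂ) 1) := fun k hk =>
    (hk.continuousOn.integrableOn_compact (isCompact_closedBall 0 1)).mono_set
      ball_subset_closedBall
  have hre : ∀ u ∈ ball (0 : ℂ) 1, |u.re| ≤ 1 := fun u hu =>
    (Complex.abs_re_le_norm u).trans (by simpa using (mem_ball_zero_iff.1 hu).le)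
  have hgc := hg.continuous
  have hg2c := hg2.continuous
  have hsm : ∀ r : ℝ, 0 < r → ∀ u ∈ ball (0 : ℂ) 1, ‖(r : ℂ) * u‖ ^ 2 ≤ r ^ 2 := by
    intro r hr u hu
    have : ‖u‖ ≤ 1 := by simpa using (mem_ball_zero_iff.1 hu).le
    rw [norm_mul, mul_pow]
    simp only [Complex.norm_real, Real.norm_eq_abs, sq_abs]
    nlinarith [sq_nonneg r, norm_nonneg u, pow_le_one₀ (norm_nonneg u) this (n := 2)]
  have low : ∀ r : ℝ, 0 < r → c * fderiv ℝ (mollify f φ) z 1 * r - Real.pi * L1 * r ^ 2 ≤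
      ∫ u in ball (0 : ℂ) 1, u.re * mollify f φ (z + r * u) := by
    intro r hr
    set D := fderiv ℝ (mollify f φ) z
    have hre1 : ∫ u in ball (0 : ℂ) 1, u.re = 0 :=
      setIntegral_ball_eq_zero_of_odd _ (fun u => by simp) 1
    have e : ∫ u in ball (0 : ℂ) 1, (u.re * mollify f φ z + r * (u.re * D u) - L1 * r ^ 2) =
        c * D 1 * r - Real.pi * L1 * r ^ 2 := by
      rw [integral_sub (hI _ (by fun_prop)) (hI _ (by fun_prop)),
        integral_add (hI _ (by fun_prop)) (hI _ (by fun_prop)), integral_mul_const, hre1,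
        integral_const_mul, hcl, setIntegral_const, volume_real_unit_ball, smul_eq_mul]
      ring
    rw [← e]
    refine setIntegral_mono_on (hI _ (by fun_prop)) (hI _ (by fun_prop)) measurableSet_ball
      fun u hu => ?_
    have h1 := T1 z (r * u)
    have h2 : D (r * u) = r * D u := by
      rw [← Complex.real_smul, map_smul, smul_eq_mul]
    change |mollify f φ (z + r * u) - mollify f φ z - D (r * u)| ≤ _ at h1
    have h3 : |u.re * (mollify f φ (z + r * u) - mollify f φ z - D (r * u))| ≤ L1 * r ^ 2 := by
      rw [abs_mul]
      calc _ ≤ 1 * (L1 * ‖(r : ℂ) * u‖ ^ 2) := by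
            gcongr
            exact hre u hu
        _ ≤ _ := by
            rw [one_mul]
            exact mul_le_mul_of_nonneg_left (hsm r hr u hu) hL1
    rw [h2] at h3
    nlinarith [neg_abs_le (u.re * (mollify f φ (z + r * u) - mollify f φ z - r * D u))]
  -- Second-order Taylor expansion of the mollified square: the linear term has mean zero, so the
  -- defect is of order `r ^ 2`. This replaces an energy estimate for the gradient.
  have up : ∀ r : ℝ, 0 < r → (∫ u in ball (0 : ℂ) 1, 1 * mollify f2 φ (z + r * u)) -
      Real.pi * mollify f2 φ z ≤ Real.pi * L2 * r ^ 2 := by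
    intro r hr
    set D := fderiv ℝ (mollify f2 φ) z
    have hre1 : ∫ u in ball (0 : ℂ) 1, D u = 0 :=
      setIntegral_ball_eq_zero_of_odd _ (fun u => by simp) 1
    have e : ∫ u in ball (0 : ℂ) 1, (mollify f2 φ z + r * D u + L2 * r ^ 2) =
        Real.pi * mollify f2 φ z + Real.pi * L2 * r ^ 2 := by
      rw [integral_add (hI _ (by fun_prop)) (hI _ (by fun_prop)),
        integral_add (hI _ (by fun_prop)) (hI _ (by fun_prop)),
        integral_const_mul, hre1, setIntegral_const, setIntegral_const, volume_real_unit_ball,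
        smul_eq_mul, smul_eq_mul]
      ring
    rw [sub_le_iff_le_add', ← e]
    refine setIntegral_mono_on (hI _ (by fun_prop)) (hI _ (by fun_prop)) measurableSet_ball
      fun u hu => ?_
    have h1 := T2 z (r * u)
    have h2 : D (r * u) = r * D u := by
      rw [← Complex.real_smul, map_smul, smul_eq_mul]
    change |mollify f2 φ (z + r * u) - mollify f2 φ z - D (r * u)| ≤ _ at h1
    rw [h2] at h1
    have h3 := mul_le_mul_of_nonneg_left (hsm r hr u hu) hL2
    linarith [le_abs_self (mollify f2 φ (z + r * u) - mollify f2 φ z - r * D u)]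
  have key : ∀ ε : ℝ, 0 < ε → ∀ r : ℝ, 0 < r → r < δ →
      c * fderiv ℝ (mollify f φ) z 1 ≤ Real.pi * L1 * r +
        Real.pi * Φ / (2 * ε) * volume.real (thickening r K) + ε * (Real.pi * L2 / 2) := by
    intro ε hε r hr hrδ
    have hKfin : volume (thickening r K) ≠ ∞ := (hK.isBounded.thickening).measure_lt_top.ne
    obtain ⟨j1, s1⟩ := setIntegral_mul_mollify hfm hfM' hφ.continuous hφc
      Complex.measurable_re hre z r
    obtain ⟨j2, s2⟩ := setIntegral_mul_mollify hf2m hf2M hφ.continuous hφc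
      (k := fun _ => 1) measurable_const (by simp) z r
    have j3 : Integrable (fun w => f2 w * φ (z - w)) := by
      have h1 : Integrable (fun w : ℂ => φ (z - w)) :=
        (hφ.continuous.integrable_of_hasCompactSupport hφc).comp_sub_left z
      exact h1.bdd_mul (c := M ^ 2) hf2m.aestronglyMeasurable (ae_of_all _ hf2M)
    have j4 : Integrable ((thickening r K).indicator fun _ : ℂ => Φ * (Real.pi * r / (2 * ε))) :=
      (integrable_indicator_iff isOpen_thickening.measurableSet).2 (integrableOn_const hKfin)
    have j5 : Integrable (fun w => ε / (2 * r) *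
        (φ (z - w) * (∫ u in ball (0 : ℂ) 1, 1 * f2 (w + r * u)) - Real.pi * (f2 w * φ (z - w)))) :=
      (j2.sub (j3.const_mul Real.pi)).const_mul (ε / (2 * r))
    have main : ∫ w, φ (z - w) * ∫ u in ball (0 : ℂ) 1, u.re * f (w + r * u) ≤
        Φ * (Real.pi * r / (2 * ε)) * volume.real (thickening r K) +
          ε / (2 * r) * ((∫ u in ball (0 : ℂ) 1, 1 * mollify f2 φ (z + r * u)) -
            Real.pi * mollify f2 φ z) := by
      rw [s2, mollify, ← integral_const_mul, ← integral_sub j2 (j3.const_mul _),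
        ← integral_const_mul]
      have : Φ * (Real.pi * r / (2 * ε)) * volume.real (thickening r K) =
          ∫ w, (thickening r K).indicator (fun _ : ℂ => Φ * (Real.pi * r / (2 * ε))) w := by
        rw [integral_indicator isOpen_thickening.measurableSet, setIntegral_const, smul_eq_mul,
          mul_comm]
      rw [this, ← integral_add j4 j5]
      refine integral_mono j1 (j4.add j5) fun w => ?_
      have hΦw : φ (z - w) ≤ Φ := (le_abs_self _).trans (hΦ _)
      have hind : 0 ≤ (thickening r K).indicator
          (fun _ : ℂ => Φ * (Real.pi * r / (2 * ε))) w :=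
        indicator_nonneg (fun _ _ => by positivity) _
      simp only [one_mul]
      by_cases h0 : φ (z - w) = 0
      · simp only [h0, zero_mul, mul_zero, sub_zero, add_zero]
        exact hind
      have hsq := setIntegral_sq_sub_le hfm hf0 hfM (sub w h0 r hr hrδ)
      have hdef : 0 ≤ (∫ u in ball (0 : ℂ) 1, f2 (w + r * u)) - Real.pi * f2 w :=
        (integral_nonneg fun _ => sq_nonneg _).trans hsq.2
      have e : ε / (2 * r) * (φ (z - w) * (∫ u in ball (0 : ℂ) 1, f2 (w + r * u)) -
          Real.pi * (f2 w * φ (z - w))) = φ (z - w) * (ε / (2 * r) *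
            ((∫ u in ball (0 : ℂ) 1, f2 (w + r * u)) - Real.pi * f2 w)) := by ring
      rw [e]
      -- Only centres within `r` of `K` pay the cost `r / ε`. Elsewhere `mono` applies, and the
      -- nonnegative defect can be added freely.
      by_cases hw : w ∈ thickening r K
      · rw [indicator_of_mem hw]
        have h1 := setIntegral_re_mul_le hfm hf0 hfM hr hε (sub w h0 r hr hrδ)
        have h2 := mul_le_mul_of_nonneg_left h1 (hφ0 (z - w))
        rw [mul_add] at h2
        refine h2.trans (add_le_add ?_ le_rfl)
        gcongr
      · have hd : Disjoint (ball w r) K := by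
          rw [disjoint_left]
          intro x hx hxK
          exact hw (mem_thickening_iff.2 ⟨x, hxK, by rwa [dist_comm]⟩)
        have h1 := mono w h0 r hr hrδ hd
        have h2 := mul_nonpos_of_nonneg_of_nonpos (hφ0 (z - w)) h1
        have h3 := hφ0 (z - w)
        have h4 : 0 ≤ φ (z - w) * (ε / (2 * r) *
            ((∫ u in ball (0 : ℂ) 1, f2 (w + r * u)) - Real.pi * f2 w)) := by positivity
        linarith
    have h1 := low r hr
    rw [s1] at h1
    have h2 : ε / (2 * r) * ((∫ u in ball (0 : ℂ) 1, 1 * mollify f2 φ (z + r * u)) -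
            Real.pi * mollify f2 φ z) ≤ ε / (2 * r) * (Real.pi * L2 * r ^ 2) := by
      gcongr
      exact up r hr
    have h3 := h1.trans (main.trans (add_le_add le_rfl h2))
    refine le_of_mul_le_mul_right ?_ hr
    calc _ ≤ _ := sub_le_iff_le_add.1 h3
      _ = _ := by field_simp; ring
  -- With `ε` fixed, the area of `thickening r K` tends to `volume K = 0`.
  have lim : ∀ ε : ℝ, 0 < ε → c * fderiv ℝ (mollify f φ) z 1 ≤ ε * (Real.pi * L2 / 2) := by
    intro ε hε
    have t1 : Tendsto (fun r => volume.real (thickening r K)) (𝓝[>] 0) (𝓝 0) := by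
      have := tendsto_measure_thickening_of_isClosed (μ := volume) (s := K)
        ⟨1, one_pos, hK.isBounded.thickening.measure_lt_top.ne⟩ hK.isClosed
      rw [hK0] at this
      exact (ENNReal.tendsto_toReal ENNReal.zero_ne_top).comp this
    have t2 : Tendsto (fun r : ℝ => r) (𝓝[>] 0) (𝓝 0) := tendsto_nhdsWithin_of_tendsto_nhds
      tendsto_id
    have t3 := ((t2.const_mul (Real.pi * L1)).add (t1.const_mul (Real.pi * Φ / (2 * ε)))).add_const
      (ε * (Real.pi * L2 / 2))
    rw [mul_zero, mul_zero, zero_add, zero_add] at t3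
    refine ge_of_tendsto t3 ?_
    filter_upwards [Ioo_mem_nhdsGT hδ] with r hr
    exact key ε hε r hr.1 hr.2
  have lim2 : c * fderiv ℝ (mollify f φ) z 1 ≤ 0 := by
    have t2 : Tendsto (fun r : ℝ => r) (𝓝[>] 0) (𝓝 0) := tendsto_nhdsWithin_of_tendsto_nhds
      tendsto_id
    have t3 := t2.mul_const (Real.pi * L2 / 2)
    rw [zero_mul] at t3
    refine ge_of_tendsto t3 ?_
    filter_upwards [self_mem_nhdsWithin] with ε hε
    exact lim ε hε
  exact nonpos_of_mul_nonpos_right lim2 hc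

/-! ### Polar coordinates and reflection -/

theorem setLIntegral_ball_eq_polar {F : ℂ → ℝ≥0∞} (hF : Measurable F) (z : ℂ) (r : ℝ) :
    ∫⁻ w in ball z r, F w = ∫⁻ ρ in Ioo 0 r, ENNReal.ofReal ρ *
      ∫⁻ θ in Ioc 0 (2 * Real.pi), F (circleMap z ρ θ) := by
  have hper : ∀ ρ : ℝ, ∫⁻ θ in Ioo (-Real.pi) Real.pi, F (circleMap z ρ θ) =
      ∫⁻ θ in Ioc 0 (2 * Real.pi), F (circleMap z ρ θ) := by
    intro ρ
    rw [setLIntegral_congr (Ioo_ae_eq_Ioc (a := -Real.pi) (b := Real.pi))]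
    have h1 := isAddFundamentalDomain_Ioc Real.two_pi_pos (-Real.pi)
    have h2 := isAddFundamentalDomain_Ioc Real.two_pi_pos 0
    rw [zero_add] at h2
    rw [show -Real.pi + 2 * Real.pi = Real.pi by ring] at h1
    refine h1.setLIntegral_eq h2 _ ?_
    rintro ⟨g, hg⟩ x
    obtain ⟨n, rfl⟩ := AddSubgroup.mem_zmultiples_iff.1 hg
    have := ((periodic_circleMap z ρ).zsmul n) x
    simp only [AddSubgroup.vadd_def, vadd_eq_add]
    rw [add_comm, this]
  have hind : ∫⁻ w in ball z r, F w = ∫⁻ w, (ball z r).indicator F (z + w) := by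
    rw [lintegral_add_left_eq_self, lintegral_indicator measurableSet_ball]
  have hm : Measurable fun w => (ball z r).indicator F (z + w) :=
    (hF.indicator measurableSet_ball).comp (measurable_const_add z)
  have hcm : Measurable fun p : ℝ × ℝ => Complex.polarCoord.symm p := by
    simp only [Complex.polarCoord_symm_apply]
    fun_prop
  have hmp : Measurable fun p : ℝ × ℝ => ENNReal.ofReal p.1 •
      (ball z r).indicator F (z + Complex.polarCoord.symm p) :=
    (ENNReal.measurable_ofReal.comp measurable_fst).mul (hm.comp hcm)
  rw [hind, ← Complex.lintegral_comp_polarCoord_symm, polarCoord_target,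
    Measure.volume_eq_prod, setLIntegral_prod _ hmp.aemeasurable,
    ← lintegral_indicator measurableSet_Ioi, ← lintegral_indicator measurableSet_Ioo]
  refine lintegral_congr fun ρ => ?_
  by_cases hρ : 0 < ρ
  swap
  · rw [indicator_of_notMem (by simpa using hρ), indicator_of_notMem (by simp [hρ])]
  rw [indicator_of_mem (by simpa using hρ)]
  have hc : ∀ θ : ℝ, z + Complex.polarCoord.symm (ρ, θ) = circleMap z ρ θ := by
    intro θ
    simp [circleMap, Complex.exp_mul_I]
  have hb : ∀ θ : ℝ, circleMap z ρ θ ∈ ball z r ↔ ρ < r := fun θ => by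
    simp [mem_ball, abs_of_pos hρ, dist_eq_norm, circleMap]
  simp only [hc, smul_eq_mul]
  by_cases hr : ρ < r
  · rw [indicator_of_mem (by simp [hr, hρ]), lintegral_const_mul _ (by
      have := (continuous_circleMap z ρ).measurable
      exact (hF.indicator measurableSet_ball).comp this), ← hper]
    congr 2
    ext θ
    rw [indicator_of_mem ((hb θ).2 hr)]
  · rw [indicator_of_notMem (by simp [hr])]
    have : ∀ θ, (ball z r).indicator F (circleMap z ρ θ) = 0 := fun θ =>
      indicator_of_notMem (by rw [hb]; exact hr) _
    simp [this]

/-- Pair `u` with its mirror image `-conj u`: the weight changes sign, and `f` is no larger at the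
right-hand point. -/
theorem setIntegral_re_mul_nonpos {f : ℂ → ℝ} {M : ℝ} (hfm : Measurable f)
    (hfM : ∀ w, |f w| ≤ M) {w : ℂ} {r : ℝ}
    (anti : ∀ u ∈ ball (0 : ℂ) 1, 0 ≤ u.re → f (w + r * u) ≤ f (w + r * -(starRingEnd ℂ u))) :
    ∫ u in ball (0 : ℂ) 1, u.re * f (w + r * u) ≤ 0 := by
  have hre : ∀ u ∈ ball (0 : ℂ) 1, |u.re| ≤ 1 := fun u hu =>
    (Complex.abs_re_le_norm u).trans (by simpa using (mem_ball_zero_iff.1 hu).le)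
  have hi : ∀ g : ℂ → ℝ, Measurable g → (∀ u, |g u| ≤ M) →
      IntegrableOn (fun u : ℂ => u.re * g u) (ball (0 : ℂ) 1) := fun g hg hgM =>
    Measure.integrableOn_of_bounded (M := 1 * M) measure_ball_lt_top.ne
      (Complex.measurable_re.mul hg).aestronglyMeasurable
      ((ae_restrict_iff' measurableSet_ball).2 (ae_of_all _ fun u hu => by
        rw [Real.norm_eq_abs, abs_mul]
        exact mul_le_mul (hre u hu) (hgM _) (abs_nonneg _) zero_le_one))
  have hconj : Measurable (starRingEnd ℂ) := Complex.continuous_conj.measurable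
  have i1 := hi (fun u => f (w + r * u)) (by fun_prop) (fun _ => hfM _)
  have i2 := hi (fun u => f (w + r * -(starRingEnd ℂ u))) (by fun_prop) (fun _ => hfM _)
  have h1 := setIntegral_ball_comp_conj (fun u => u.re * f (w + r * u)) 1
  simp only [Complex.neg_re, Complex.conj_re, neg_mul, integral_neg] at h1
  have h2 : ∫ u in ball (0 : ℂ) 1,
      (u.re * f (w + r * u) - u.re * f (w + r * -(starRingEnd ℂ u))) ≤ 0 := by
    refine setIntegral_nonpos measurableSet_ball fun u hu => ?_
    rw [← mul_sub]
    rcases le_total 0 u.re with h | h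
    · exact mul_nonpos_of_nonneg_of_nonpos h (sub_nonpos.2 (anti u hu h))
    · have := anti (-(starRingEnd ℂ u)) (by simpa using hu) (by simpa using h)
      simp only [map_neg, Complex.conj_conj, neg_neg] at this
      exact mul_nonpos_of_nonpos_of_nonneg h (sub_nonneg.2 this)
  rw [integral_sub i1 i2] at h2
  linarith

/-! ### Area means and the maximum principle -/

/-- The extension by `0` of `V` restricted to `Ω`. -/
noncomputable def zeroExtend (V : ℂ → EReal) (Ω : Opens ℂ) : ℂ → EReal :=
  (Ω : Set ℂ).indicator V

namespace IsSubharmonicOn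

variable {V : ℂ → EReal} {Ω : Opens ℂ}

theorem measurable_zeroExtend (hV : IsSubharmonicOn V Ω) : Measurable (zeroExtend V Ω) := by
  refine measurable_of_Iio fun c => ?_
  have h : IsOpen {z | z ∈ Ω ∧ V z < c} := by
    rw [isOpen_iff_mem_nhds]
    rintro z ⟨hz, hc⟩
    have h1 := hV.upperSemicontinuousOn z hz c hc
    rw [Ω.isOpen.nhdsWithin_eq hz] at h1
    filter_upwards [h1, Ω.isOpen.mem_nhds hz] with x hx hxΩ using ⟨hxΩ, hx⟩
  have e : zeroExtend V Ω ⁻¹' Iio c = {z | z ∈ Ω ∧ V z < c} ∪ ((Ω : Set ℂ)ᶜ ∩ {_z | 0 < c}) := by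
    ext z
    by_cases hz : z ∈ Ω
    · simp [zeroExtend, hz]
    · simp [zeroExtend, hz]
  rw [e]
  exact h.measurableSet.union (Ω.isOpen.measurableSet.compl.inter (MeasurableSet.const _))

/-- Dropping the subtracted negative mean only enlarges the right-hand side, so the positive part
inherits the sub-mean-value inequality. -/
theorem toENNReal_le (hV : IsSubharmonicOn V Ω) {z : ℂ} {r : ℝ} (hr : 0 < r)
    (h : closedBall z r ⊆ (Ω : Set ℂ)) :
    (V z).toENNReal ≤ ENNReal.ofReal (2 * Real.pi)⁻¹ *
      ∫⁻ θ in Ioc 0 (2 * Real.pi), (V (circleMap z r θ)).toENNReal := by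
  have h0 : ∀ a b : ℝ≥0∞, (a : EReal) - b ≤ a := fun a b => by
    rw [sub_eq_add_neg]
    refine add_le_of_nonpos_right ?_
    rw [← neg_zero, EReal.neg_le_neg_iff]
    exact EReal.coe_ennreal_nonneg b
  have h1 := (hV.le_circleMean z r hr h).trans (h0 _ _)
  have h2 := EReal.toENNReal_le_toENNReal h1
  rwa [EReal.toENNReal_coe] at h2

theorem zeroExtend_circleMap {z : ℂ} {ρ r : ℝ} (h : ball z r ⊆ (Ω : Set ℂ)) (h0 : 0 < ρ)
    (hρ : ρ < r) (θ : ℝ) : zeroExtend V Ω (circleMap z ρ θ) = V (circleMap z ρ θ) := by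
  refine indicator_of_mem (h ?_) _
  simp [mem_ball, abs_of_pos h0, dist_eq_norm, circleMap, hρ]

theorem toENNReal_le_setLIntegral (hV : IsSubharmonicOn V Ω) {z : ℂ} {r : ℝ} (hr : 0 < r)
    (h : ball z r ⊆ (Ω : Set ℂ)) :
    ENNReal.ofReal (Real.pi * r ^ 2) * (V z).toENNReal ≤
      ∫⁻ w in ball z r, (zeroExtend V Ω w).toENNReal := by
  rw [setLIntegral_ball_eq_polar hV.measurable_zeroExtend.ereal_toENNReal]
  have h1 : ∀ ρ ∈ Ioo 0 r, ENNReal.ofReal (2 * Real.pi) * (V z).toENNReal ≤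
      ∫⁻ θ in Ioc 0 (2 * Real.pi), (zeroExtend V Ω (circleMap z ρ θ)).toENNReal := by
    intro ρ hρ
    simp_rw [zeroExtend_circleMap h hρ.1 hρ.2]
    have := hV.toENNReal_le hρ.1 ((closedBall_subset_ball hρ.2).trans h)
    calc _ ≤ ENNReal.ofReal (2 * Real.pi) * _ := mul_le_mul_right this _
      _ = _ := by
        rw [← mul_assoc, ← ENNReal.ofReal_mul (by positivity),
          mul_inv_cancel₀ (by positivity), ENNReal.ofReal_one, one_mul]
  have h2 : ∫⁻ ρ in Ioo 0 r, ENNReal.ofReal ρ = ENNReal.ofReal (r ^ 2 / 2) := by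
    rw [← ofReal_integral_eq_lintegral_ofReal, ← integral_Ioc_eq_integral_Ioo,
      ← intervalIntegral.integral_of_le hr.le, integral_id]
    · simp
    · exact (continuous_id.integrableOn_Icc).mono_set Ioo_subset_Icc_self
    · filter_upwards [ae_restrict_mem measurableSet_Ioo] with x hx using hx.1.le
  calc _ = ∫⁻ ρ in Ioo 0 r, ENNReal.ofReal ρ *
        (ENNReal.ofReal (2 * Real.pi) * (V z).toENNReal) := by
        rw [lintegral_mul_const _ (by fun_prop), h2, ← mul_assoc,
          ← ENNReal.ofReal_mul (by positivity)]
        congr 2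
        ring
    _ ≤ _ := by
        refine setLIntegral_mono' measurableSet_Ioo fun ρ hρ => ?_
        exact mul_le_mul_right (h1 ρ hρ) _

/-- The strong maximum principle: a subharmonic function with a local maximum `0` at the centre of
a disk vanishes almost everywhere in the disk. -/
theorem ae_eq_zero_of_nonpos (hV : IsSubharmonicOn V Ω) {p : ℂ} {r : ℝ}
    (h : ball p r ⊆ (Ω : Set ℂ)) (hp : V p = 0) (hle : ∀ z ∈ ball p r, V z ≤ 0) :
    ∀ᵐ z, z ∈ ball p r → V z = 0 := by
  have hG : Measurable fun z => (-zeroExtend V Ω z).toENNReal :=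
    hV.measurable_zeroExtend.neg.ereal_toENNReal
  have h0 : ∫⁻ w in ball p r, (-zeroExtend V Ω w).toENNReal = 0 := by
    rw [setLIntegral_ball_eq_polar hG]
    rw [setLIntegral_congr_fun (g := fun _ => 0) measurableSet_Ioo, lintegral_zero]
    intro ρ hρ
    -- The positive mean is zero and `V p = 0`, so the negative mean must vanish on each circle.
    have h1 := hV.le_circleMean p ρ hρ.1 ((closedBall_subset_ball hρ.2).trans h)
    have h2 : ∀ θ, (V (circleMap p ρ θ)).toENNReal = 0 := fun θ => by
      refine EReal.toENNReal_of_nonpos (hle _ ?_)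
      simp [mem_ball, abs_of_pos hρ.1, dist_eq_norm, circleMap, hρ.2]
    rw [circleMean, hp] at h1
    simp only [h2, lintegral_zero, mul_zero, EReal.coe_ennreal_zero, zero_sub] at h1
    have h3 := EReal.neg_le_neg_iff.2 h1
    rw [neg_neg, neg_zero] at h3
    have h4 := EReal.coe_ennreal_eq_zero.1 (le_antisymm h3 (EReal.coe_ennreal_nonneg _))
    have h5 := (mul_eq_zero.1 h4).resolve_left (by
      rw [ENNReal.ofReal_eq_zero, not_le]; positivity)
    simp only [zeroExtend_circleMap h hρ.1 hρ.2, h5, mul_zero]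
  rw [lintegral_eq_zero_iff hG, Filter.EventuallyEq, ae_restrict_iff' measurableSet_ball] at h0
  filter_upwards [h0] with z hz hzr
  have h1 := hz hzr
  rw [zeroExtend, indicator_of_mem (h hzr), Pi.zero_apply, EReal.toENNReal_eq_zero_iff,
    ← neg_zero, EReal.neg_le_neg_iff] at h1
  exact le_antisymm (hle z hzr) h1

end IsSubharmonicOn

/-! ### Locality of the distributional Laplacian -/

theorem TestFunction.notMem_tsupport_lineDerivOp {Ω : Opens ℂ} (u : 𝓓(Ω, ℝ)) (v x : ℂ)
    (hx : x ∉ tsupport u) : x ∉ tsupport (∂_{v} u : 𝓓(Ω, ℝ)) := by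
  have h : (fun y => u y) =ᶠ[𝓝 x] fun _ => 0 := notMem_tsupport_iff_eventuallyEq.1 hx
  rw [notMem_tsupport_iff_eventuallyEq]
  filter_upwards [h.eventuallyEq_nhds] with y hy
  rw [TestFunction.lineDerivOp_eq_lineDerivCLM ℝ, TestFunction.lineDerivCLM_apply_of_le (by simp)]
  rw [Filter.EventuallyEq.lineDeriv_eq hy]
  simp [lineDeriv]

theorem notMem_laplacianSupport_of_ae_eq_zero {V : ℂ → EReal} {Ω : Opens ℂ} {p : ℂ} {r : ℝ}
    (hr : 0 < r) (h : ∀ᵐ z, z ∈ ball p r → V z = 0) : p ∉ laplacianSupport V Ω := by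
  rintro ⟨hp, -⟩
  refine (Distribution.notMem_dsupport_iff p).2 ⟨ball p r, ?_, isOpen_ball, mem_ball_self hr⟩ hp
  intro u hu
  have key : ∀ v : 𝓓(Ω, ℝ), (∀ x, x ∉ tsupport u → x ∉ tsupport v) →
      toDistribution V Ω v = 0 := by
    intro v hv
    have e : ∫ x, (ContinuousLinearMap.mul ℝ ℝ) (v x) (V x).toReal = 0 := by
      refine integral_eq_zero_of_ae ?_
      filter_upwards [h] with x hx
      by_cases hxb : x ∈ ball p r
      · simp [hx hxb]
      · have := image_eq_zero_of_notMem_tsupport (hv x fun hxu => hxb (hu hxu))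
        simp [this]
    change (TestFunction.integralAgainstBilinCLM (ContinuousLinearMap.mul ℝ ℝ) volume
      (fun z => (V z).toReal) : 𝓓(Ω, ℝ) →L[ℝ] ℝ) v = 0
    -- The pairing defaults to `0` when `V` is not locally integrable; both branches vanish here.
    rw [TestFunction.integralAgainstBilinCLM_apply, e, ite_self]
  have key2 : ∀ a : ℂ, (∂_{a} (∂_{a} (toDistribution V Ω) : 𝓓'(Ω, ℝ)) : 𝓓'(Ω, ℝ)) u = 0 := by
    intro a
    rw [Distribution.lineDerivOp_apply_apply, map_neg, Distribution.lineDerivOp_apply_apply,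
      map_neg, neg_neg]
    exact key _ fun x hx => TestFunction.notMem_tsupport_lineDerivOp _ _ _
      (TestFunction.notMem_tsupport_lineDerivOp _ _ _ hx)
  change (∂_{(1 : ℂ)} (∂_{(1 : ℂ)} (toDistribution V Ω) : 𝓓'(Ω, ℝ)) : 𝓓'(Ω, ℝ)) u +
    (∂_{Complex.I} (∂_{Complex.I} (toDistribution V Ω) : 𝓓'(Ω, ℝ)) : 𝓓'(Ω, ℝ)) u = 0
  rw [key2, key2, add_zero]

/-! ### The positive part of a subharmonic function -/

/-- The positive part of `V` in `s`, extended by `0`. -/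
noncomputable def localPosPart (V : ℂ → EReal) (s : Set ℂ) : ℂ → ℝ :=
  s.indicator fun w => max 0 (V w).toReal

theorem localPosPart_nonneg (V : ℂ → EReal) (s : Set ℂ) (w : ℂ) : 0 ≤ localPosPart V s w :=
  indicator_nonneg (fun _ _ => le_max_left _ _) _

namespace IsSubharmonicOn

variable {V : ℂ → EReal} {Ω : Opens ℂ}

/-- The convention `(⊥ : EReal).toReal = 0` is harmless, since the positive part of `-∞` is `0`. -/
theorem ofReal_localPosPart (hV : IsSubharmonicOn V Ω) {s : Set ℂ} (hs : s ⊆ (Ω : Set ℂ)) {w : ℂ}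
    (hw : w ∈ s) : ENNReal.ofReal (localPosPart V s w) = (V w).toENNReal := by
  rw [localPosPart, indicator_of_mem hw, EReal.toENNReal_of_ne_top (hV.lt_top w (hs hw)).ne,
    ENNReal.ofReal_max, ENNReal.ofReal_zero, max_eq_right zero_le]

theorem measurable_localPosPart (hV : IsSubharmonicOn V Ω) {s : Set ℂ} (hs : s ⊆ (Ω : Set ℂ))
    (hsm : MeasurableSet s) : Measurable (localPosPart V s) := by
  have e : localPosPart V s = s.indicator fun w => max 0 (zeroExtend V Ω w).toReal := by
    refine indicator_congr fun w hw => ?_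
    rw [zeroExtend, indicator_of_mem (hs hw)]
  rw [e]
  exact (measurable_const.max hV.measurable_zeroExtend.ereal_toReal).indicator hsm

theorem exists_localPosPart_le (hV : IsSubharmonicOn V Ω) {s t : Set ℂ} (ht : IsCompact t)
    (hst : s ⊆ t) (htΩ : t ⊆ (Ω : Set ℂ)) : ∃ M : ℝ, ∀ w, localPosPart V s w ≤ M := by
  rcases s.eq_empty_or_nonempty with rfl | hs
  · exact ⟨0, fun w => by simp [localPosPart]⟩
  obtain ⟨a, ha, hmax⟩ :=
    (hV.upperSemicontinuousOn.mono htΩ).exists_isMaxOn (hs.mono hst) ht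
  refine ⟨max 0 (V a).toReal, fun w => ?_⟩
  by_cases hw : w ∈ s
  · rw [localPosPart, indicator_of_mem hw]
    by_cases hb : V w = ⊥
    · simp [hb]
    · exact max_le_max le_rfl
        (EReal.toReal_le_toReal (hmax (hst hw)) hb (hV.lt_top a (htΩ ha)).ne)
  · rw [localPosPart, indicator_of_notMem hw]
    exact le_max_left _ _

theorem localPosPart_le_setIntegral (hV : IsSubharmonicOn V Ω) {s : Set ℂ}
    (hs : s ⊆ (Ω : Set ℂ)) (hsm : MeasurableSet s) {M : ℝ} (hM : ∀ w, localPosPart V s w ≤ M)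
    {w : ℂ} {r : ℝ} (hr : 0 < r) (hw : ball w r ⊆ s) :
    Real.pi * r ^ 2 * localPosPart V s w ≤ ∫ x in ball w r, localPosPart V s x := by
  have h1 := hV.toENNReal_le_setLIntegral hr (hw.trans hs)
  have h2 : ∫⁻ x in ball w r, (zeroExtend V Ω x).toENNReal =
      ENNReal.ofReal (∫ x in ball w r, localPosPart V s x) := by
    rw [ofReal_integral_eq_lintegral_ofReal]
    · refine setLIntegral_congr_fun measurableSet_ball fun x hx => ?_
      rw [hV.ofReal_localPosPart hs (hw hx), zeroExtend, indicator_of_mem (hs (hw hx))]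
    · exact Measure.integrableOn_of_bounded (M := M) measure_ball_lt_top.ne
        (hV.measurable_localPosPart hs hsm).aestronglyMeasurable (ae_of_all _ fun x => by
          rw [Real.norm_eq_abs, abs_of_nonneg (localPosPart_nonneg _ _ _)]
          exact hM x)
    · exact ae_of_all _ fun x => localPosPart_nonneg _ _ _
  rw [h2, ← hV.ofReal_localPosPart hs (hw (mem_ball_self hr)),
    ← ENNReal.ofReal_mul (by positivity)] at h1
  exact (ENNReal.ofReal_le_ofReal_iff
    (integral_nonneg fun _ => localPosPart_nonneg _ _ _)).1 h1

end IsSubharmonicOn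

/-! ### Horizontal monotonicity off the support -/

theorem setIntegral_comp_add_mul (f : ℂ → ℝ) (w : ℂ) {r : ℝ} (hr : 0 < r) :
    ∫ u in ball (0 : ℂ) 1, f (w + r * u) = (r ^ 2)⁻¹ * ∫ x in ball w r, f x := by
  have h1 := Measure.setIntegral_comp_smul_of_pos (volume : Measure ℂ) (fun x => f (w + x))
    (ball (0 : ℂ) 1) hr
  simp only [Complex.real_smul, Complex.finrank_real_complex, smul_eq_mul] at h1
  rw [h1, smul_unitBall hr.ne', Real.norm_eq_abs, abs_of_pos hr]
  congr 1
  rw [← (measurePreserving_add_left volume w).setIntegral_preimage_emb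
    (measurableEmbedding_addLeft w) f (ball w r)]
  congr 2
  ext x
  simp

theorem re_dz (V : ℂ → EReal) (z : ℂ) :
    (dz V z).re = fderiv ℝ (fun w => (V w).toReal) z 1 / 2 := by
  simp [dz]
  ring

theorem toReal_add_le_of_re_dz_neg {V : ℂ → EReal} {a : ℂ} {t : ℝ} (ht : 0 ≤ t)
    (h : ∀ x ∈ Icc 0 t, (dz V (a + (x : ℝ))).re < 0) :
    (V (a + t)).toReal ≤ (V a).toReal := by
  have hd : ∀ x ∈ Icc 0 t, HasDerivAt (fun x : ℝ => (V (a + x)).toReal)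
      (fderiv ℝ (fun w => (V w).toReal) (a + (x : ℝ)) 1) x := by
    intro x hx
    have h1 := h x hx
    rw [re_dz] at h1
    -- At a point of non-differentiability `fderiv` is `0` by default, contradicting the strict
    -- sign.
    have hdiff : DifferentiableAt ℝ (fun w => (V w).toReal) (a + (x : ℝ)) := by
      by_contra hn
      rw [fderiv_zero_of_not_differentiableAt hn] at h1
      simp at h1
    exact hdiff.hasFDerivAt.comp_hasDerivAt x ((Complex.ofRealCLM.hasDerivAt (x := x)).const_add a)
  have := antitoneOn_of_deriv_nonpos (convex_Icc 0 t)
    (fun x hx => (hd x hx).continuousAt.continuousWithinAt)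
    (fun x hx => (hd x (interior_subset hx)).differentiableAt.differentiableWithinAt)
    (fun x hx => by
      rw [(hd x (interior_subset hx)).deriv]
      have h1 := h x (interior_subset hx)
      rw [re_dz] at h1
      linarith)
  simpa using this (left_mem_Icc.2 ht) (right_mem_Icc.2 ht) ht

/-- A segment is connected, so it lies wholly in `U`, where `V = 0`, or wholly in `W`, where `V`
decreases. -/
theorem localPosPart_add_le {V : ℂ → EReal} {s U W : Set ℂ} (hU : IsOpen U) (hW : IsOpen W)
    (hUW : Disjoint U W) (hVU : ∀ z ∈ U, V z = 0) (hVW : ∀ z ∈ W, (dz V z).re < 0)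
    {a : ℂ} {t : ℝ} (ht : 0 ≤ t) (hs : ∀ x ∈ Icc 0 t, a + (x : ℝ) ∈ s)
    (hsUW : ∀ x ∈ Icc 0 t, a + (x : ℝ) ∈ U ∪ W) :
    localPosPart V s (a + t) ≤ localPosPart V s a := by
  have ha : a ∈ s := by simpa using hs 0 (left_mem_Icc.2 ht)
  rw [localPosPart, indicator_of_mem (hs t (right_mem_Icc.2 ht)), indicator_of_mem ha]
  have hpre : IsPreconnected ((fun x : ℝ => a + (x : ℂ)) '' Icc 0 t) :=
    isPreconnected_Icc.image _ (by fun_prop)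
  have hsub : (fun x : ℝ => a + (x : ℂ)) '' Icc 0 t ⊆ U ∪ W := image_subset_iff.2 hsUW
  rcases isPreconnected_iff_subset_of_disjoint.1 hpre U W hU hW hsub
    (by rw [hUW.inter_eq, inter_empty]) with h | h
  · rw [hVU _ (h ⟨t, right_mem_Icc.2 ht, rfl⟩)]
    simp
  · exact max_le_max le_rfl (toReal_add_le_of_re_dz_neg ht fun x hx => hVW _ (h ⟨x, hx, rfl⟩))

/-! ### Propagation of `U` to the right -/

/-- If the open segment ending at `p` lies in `U`, then so does `p`. -/
theorem mem_of_segment_subset {Ω : Opens ℂ} {V : ℂ → EReal} (hV : MemSH0 V Ω)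
    {U W : Set ℂ} (hU : IsOpen U) (hW : IsOpen W) (hUW : Disjoint U W)
    (hcover : (Ω : Set ℂ) \ laplacianSupport V Ω = U ∪ W)
    (hVU : ∀ z ∈ U, V z = 0) (hVW : ∀ z ∈ W, (dz V z).re < 0)
    {p : ℂ} (hp : p ∈ Ω) {s₀ : ℝ} (hs₀ : 0 < s₀) (hseg : ∀ t ∈ Ioc 0 s₀, p - (t : ℝ) ∈ U) :
    p ∈ U := by
  have hsub := hV.isSubharmonicOn
  obtain ⟨R, hR, hRΩ⟩ := nhds_basis_closedBall.mem_iff.1 (Ω.isOpen.mem_nhds hp)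
  have hseq : Tendsto (fun t : ℝ => p - t) (𝓝[>] 0) (𝓝 p) := by
    have : Continuous fun t : ℝ => p - (t : ℂ) := by fun_prop
    simpa using (this.tendsto 0).mono_left (nhdsWithin_le_nhds (s := Ioi 0))
  have hevU : ∀ᶠ t : ℝ in 𝓝[>] 0, p - (t : ℂ) ∈ U := by
    filter_upwards [Ioc_mem_nhdsGT hs₀] with t ht using hseg t ht
  have hpW : p ∉ W := by
    intro hpW
    obtain ⟨t, h1, h2⟩ := ((hseq.eventually (hW.mem_nhds hpW)).and hevU).exists
    exact disjoint_left.1 hUW h2 h1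
  suffices hps : p ∉ laplacianSupport V Ω by
    have : p ∈ U ∪ W := hcover ▸ ⟨hp, hps⟩
    exact this.resolve_right hpW
  -- With `s, η ≤ R / 4` and `r < R / 2`, every disk of radius `r` centred within `η` of the segment
  -- from `p - s` to `p` stays in `ball p R`.
  obtain ⟨s, hs, hsR, hss₀⟩ : ∃ s : ℝ, 0 < s ∧ s ≤ R / 4 ∧ s ≤ s₀ :=
    ⟨min (R / 4) s₀, by positivity, min_le_left _ _, min_le_right _ _⟩
  have hqU : p - (s : ℂ) ∈ U := hseg s ⟨hs, hss₀⟩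
  obtain ⟨η₀, hη₀, hηU₀⟩ := Metric.isOpen_iff.1 hU _ hqU
  obtain ⟨η, hη, hηR, hηη⟩ : ∃ η : ℝ, 0 < η ∧ η ≤ R / 4 ∧ η ≤ η₀ :=
    ⟨min (R / 4) η₀, by positivity, min_le_left _ _, min_le_right _ _⟩
  have hηU : ball (p - (s : ℂ)) η ⊆ U := (ball_subset_ball hηη).trans hηU₀
  have hBΩ : ball p R ⊆ (Ω : Set ℂ) := ball_subset_closedBall.trans hRΩ
  set f : ℂ → ℝ := localPosPart V (ball p R) with hf
  have hfm : Measurable f := hsub.measurable_localPosPart hBΩ measurableSet_ball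
  have hf0 : ∀ w, 0 ≤ f w := localPosPart_nonneg _ _
  obtain ⟨M, hfM⟩ := hsub.exists_localPosPart_le (isCompact_closedBall p R)
    ball_subset_closedBall hRΩ
  have hfM' : ∀ w, |f w| ≤ M := fun w => by rw [abs_of_nonneg (hf0 w)]; exact hfM w
  have hfc : HasCompactSupport f :=
    HasCompactSupport.intro (isCompact_closedBall p R) fun x hx =>
      indicator_of_notMem (fun h => hx (ball_subset_closedBall h)) _
  let φ : ContDiffBump (0 : ℂ) := ⟨η / 2, η, by positivity, by linarith⟩
  have hφ0 : ∀ z w : ℂ, φ (z - w) ≠ 0 → w ∈ ball z η := by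
    intro z w h
    have : z - w ∈ Function.support φ := h
    rw [φ.support_eq] at this
    rw [mem_ball']
    simpa [dist_eq_norm] using this
  have hφpos : ∀ z w : ℂ, w ∈ ball z η → φ (z - w) ≠ 0 := by
    intro z w h
    change z - w ∈ Function.support φ
    rw [φ.support_eq]
    rw [mem_ball'] at h
    simpa [dist_eq_norm] using h
  have hKc : IsCompact (closedBall p R \ (U ∪ W)) :=
    (isCompact_closedBall p R).diff (hU.union hW)
  have hK0 : volume (closedBall p R \ (U ∪ W)) = 0 := by
    refine measure_mono_null ?_ hV.volume_laplacianSupport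
    rintro x ⟨hx, hxn⟩
    by_contra hxs
    exact hxn (hcover ▸ ⟨hRΩ hx, hxs⟩)
  have hsubball : ∀ t ∈ Icc 0 s, ∀ w ∈ ball (p - (t : ℂ)) η, ∀ r : ℝ, r < R / 2 →
      ball w r ⊆ ball p R := by
    intro t ht w hw r hr
    refine ball_subset_ball' ?_
    have h1 : dist w p ≤ dist w (p - t) + dist (p - (t : ℂ)) p := dist_triangle _ _ _
    have h2 : dist (p - (t : ℂ)) p = t := by
      simp [abs_of_nonneg ht.1]
    have := mem_ball.1 hw
    linarith [ht.2]
  have hder : ∀ t ∈ Icc 0 s, fderiv ℝ (mollify f φ) (p - (t : ℂ)) 1 ≤ 0 := by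
    intro t ht
    refine fderiv_mollify_one_nonpos hfm hf0 hfM hfc φ.contDiff φ.hasCompactSupport
      (fun w => φ.nonneg) hKc hK0 (half_pos hR) ?_ ?_
    · intro w hw r hr hrR
      have h1 := hsub.localPosPart_le_setIntegral hBΩ measurableSet_ball hfM hr
        (hsubball t ht w (hφ0 _ _ hw) r hrR)
      rw [setIntegral_comp_add_mul f w hr, inv_mul_eq_div, le_div_iff₀ (by positivity)]
      linarith
    · intro w hw r hr hrR hdisj
      have hb := hsubball t ht w (hφ0 _ _ hw) r hrR
      have hbUW : ball w r ⊆ U ∪ W := by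
        intro x hx
        by_contra hxn
        exact disjoint_left.1 hdisj hx ⟨ball_subset_closedBall (hb hx), hxn⟩
      refine setIntegral_re_mul_nonpos hfm hfM' fun u hu hure => ?_
      -- The horizontal chord joining the mirror image to `w + r * u` stays in the disk, hence off
      -- `K`.
      have hmem : ∀ x ∈ Icc 0 (2 * (r * u.re)),
          w + r * -(starRingEnd ℂ u) + (x : ℝ) ∈ ball w r := by
        intro x hx
        have e : w + r * -(starRingEnd ℂ u) + (x : ℝ) - w =
            (x - r * u.re : ℝ) + r * u.im * Complex.I := by
          apply Complex.ext <;> simp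
          ring
        have hu1 : ‖u‖ < 1 := mem_ball_zero_iff.1 hu
        rw [mem_ball, dist_eq_norm, e]
        have h2 : ‖((x - r * u.re : ℝ) : ℂ) + r * u.im * Complex.I‖ ^ 2 ≤ (r * ‖u‖) ^ 2 := by
          rw [mul_pow, ← Complex.normSq_eq_norm_sq, ← Complex.normSq_eq_norm_sq,
            Complex.normSq_apply, Complex.normSq_apply]
          simp
          nlinarith [hx.1, hx.2, mul_nonneg hx.1 (sub_nonneg.2 hx.2)]
        have h3 := abs_le_of_sq_le_sq h2 (by positivity)
        rw [abs_of_nonneg (norm_nonneg _)] at h3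
        nlinarith
      have e : w + r * u = w + r * -(starRingEnd ℂ u) + ((2 * (r * u.re) : ℝ) : ℂ) := by
        apply Complex.ext <;> simp
        ring
      rw [e]
      exact localPosPart_add_le hU hW hUW hVU hVW (by positivity) (fun x hx => hb (hmem x hx))
        (fun x hx => hbUW (hmem x hx))
  have hgd : Differentiable ℝ (mollify f φ) := by
    have := contDiff_mollify (n := 1) (integrable_of_bounded_of_hasCompactSupport hfm hfM' hfc)
      φ.contDiff φ.hasCompactSupport
    exact this.differentiable (by simp)
  have hmono : mollify f φ p ≤ mollify f φ (p - (s : ℂ)) := by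
    have hd : ∀ t : ℝ, HasDerivAt (fun t : ℝ => mollify f φ (p - (t : ℂ)))
        (fderiv ℝ (mollify f φ) (p - (t : ℂ)) (-1)) t := fun t =>
      (hgd _).hasFDerivAt.comp_hasDerivAt t
        ((Complex.ofRealCLM.hasDerivAt (x := t)).const_sub p)
    have := monotoneOn_of_deriv_nonneg (convex_Icc 0 s)
      (fun t _ => (hd t).continuousAt.continuousWithinAt)
      (fun t _ => (hd t).differentiableAt.differentiableWithinAt)
      (fun t ht => by
        rw [(hd t).deriv, map_neg]
        exact neg_nonneg.2 (hder t (interior_subset ht)))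
    simpa using this (left_mem_Icc.2 hs.le) (right_mem_Icc.2 hs.le) hs.le
  have hgq : mollify f φ (p - (s : ℂ)) = 0 := by
    refine integral_eq_zero_of_ae (ae_of_all _ fun w => ?_)
    by_cases hw : φ (p - (s : ℂ) - w) = 0
    · simp [hw]
    · have : f w = 0 := by
        by_cases hwB : w ∈ ball p R
        · rw [hf, localPosPart, indicator_of_mem hwB, hVU w (hηU (hφ0 _ _ hw))]
          simp
        · exact indicator_of_notMem hwB _
      simp [this]
  have hnn : ∀ w, 0 ≤ f w * φ (p - w) := fun w => mul_nonneg (hf0 w) φ.nonneg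
  have hgp : ∫ w, f w * φ (p - w) = 0 :=
    le_antisymm (hmono.trans_eq hgq) (integral_nonneg hnn)
  have hint : Integrable fun w => f w * φ (p - w) := by
    have h1 : Integrable (fun w : ℂ => φ (p - w)) :=
      (φ.continuous.integrable_of_hasCompactSupport φ.hasCompactSupport).comp_sub_left p
    exact h1.bdd_mul (c := M) hfm.aestronglyMeasurable (ae_of_all _ hfM')
  have hae : ∀ᵐ w, w ∈ ball p η → f w = 0 := by
    filter_upwards [(integral_eq_zero_iff_of_nonneg hnn hint).1 hgp] with w hw hwb
    exact (mul_eq_zero.1 hw).resolve_right (hφpos p w hwb)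
  have hηp : ball p η ⊆ ball p R := ball_subset_ball (by linarith)
  -- The area sub-mean-value inequality upgrades vanishing of `f` almost everywhere to every point.
  have hle : ∀ z ∈ ball p η, V z ≤ 0 := by
    intro z hz
    obtain ⟨r, hr, hrb⟩ := Metric.isOpen_iff.1 isOpen_ball z hz
    have h1 := hsub.localPosPart_le_setIntegral hBΩ measurableSet_ball hfM hr (hrb.trans hηp)
    have h2 : ∫ x in ball z r, f x = 0 := by
      refine integral_eq_zero_of_ae ((ae_restrict_iff' measurableSet_ball).2 ?_)
      filter_upwards [hae] with x hx hxb using hx (hrb hxb)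
    rw [← hf, h2] at h1
    have h3 : f z ≤ 0 := by
      have : 0 < Real.pi * r ^ 2 := by positivity
      exact nonpos_of_mul_nonpos_right h1 this
    have h4 := hsub.ofReal_localPosPart hBΩ (hηp hz)
    rw [← hf, ENNReal.ofReal_of_nonpos h3] at h4
    exact EReal.toENNReal_eq_zero_iff.1 h4.symm
  -- If `V p < 0`, upper semicontinuity would make `V` negative at nearby points of the segment,
  -- where it is `0`.
  have hVp : V p = 0 := by
    refine le_antisymm (hle p (mem_ball_self hη)) (not_lt.1 fun hlt => ?_)
    have h1 := hsub.upperSemicontinuousOn p hp 0 hlt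
    rw [Ω.isOpen.nhdsWithin_eq hp] at h1
    obtain ⟨t, h2, h3⟩ := ((hseq.eventually h1).and hevU).exists
    rw [hVU _ h3] at h2
    exact lt_irrefl _ h2
  exact notMem_laplacianSupport_of_ae_eq_zero hη
    (hsub.ae_eq_zero_of_nonpos (hηp.trans hBΩ) hVp hle)

end

/-! ### The first exit point of a ray -/

theorem mainTheorem3 (Ω : Opens ℂ) (hΩ : IsConnected (Ω : Set ℂ))
    (V : ℂ → EReal) (hV : MemSH0 V Ω)
    (U W : Set ℂ) (hU : IsOpen U) (hW : IsOpen W) (hUW : Disjoint U W)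
    (hcover : (Ω : Set ℂ) \ laplacianSupport V Ω = U ∪ W)
    (hVU : ∀ z ∈ U, V z = 0)
    (hVW : ∀ z ∈ W, (dz V z).re < 0) :
    U = forwardStarDomain (Ω : Set ℂ) U := by
  have hUΩ : U ⊆ (Ω : Set ℂ) := subset_union_left.trans (hcover.symm.subset.trans sdiff_subset)
  refine Subset.antisymm (fun z hz => ?_) ?_
  · obtain ⟨ε, hε, hεU⟩ := Metric.isOpen_iff.1 hU z hz
    refine ⟨hUΩ hz, z, hz, 0, le_rfl, ?_, by simp⟩
    refine lt_sSup_iff.2 ⟨(ε : EReal), ⟨by exact_mod_cast hε, fun t ht0 htε => ?_⟩,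
      by exact_mod_cast hε⟩
    refine hUΩ (hεU ?_)
    rw [Metric.mem_ball, dist_eq_norm]
    simpa [abs_of_pos ht0] using htε
  · rintro z ⟨-, ζ, hζ, t, ht0, htρ, rfl⟩
    obtain ⟨a, ⟨-, ha⟩, hta⟩ := lt_sSup_iff.1 htρ
    have hray : ∀ x ∈ Icc 0 t, ζ + (x : ℝ) ∈ Ω := by
      intro x hx
      rcases hx.1.eq_or_lt with rfl | h0
      · simpa using hUΩ hζ
      · exact ha x h0 (lt_of_le_of_lt (by exact_mod_cast hx.2) hta)
    by_contra hbad
    -- `U` is open, so `B` is closed and its infimum is the first point of the ray outside `U`; it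
    -- is positive because `ζ ∈ U`.
    set B : Set ℝ := {x | x ∈ Icc 0 t ∧ ζ + (x : ℂ) ∉ U}
    have hBc : IsClosed B := by
      have : Continuous fun x : ℝ => ζ + (x : ℂ) := by fun_prop
      exact isClosed_Icc.inter (hU.preimage this).isClosed_compl
    have hBn : B.Nonempty := ⟨t, right_mem_Icc.2 ht0, hbad⟩
    have hBb : BddBelow B := ⟨0, fun x hx => hx.1.1⟩
    obtain ⟨hx, hxU⟩ := hBc.csInf_mem hBn hBb
    set x := sInf B
    have hx0 : 0 < x := by
      refine lt_of_le_of_ne hx.1 fun h => hxU ?_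
      rw [← h]
      simpa using hζ
    refine hxU (mem_of_segment_subset hV hU hW hUW hcover hVU hVW (hray x hx) hx0 fun y hy => ?_)
    by_contra hy'
    have : x - y ∈ B := by
      refine ⟨⟨sub_nonneg.2 hy.2, by linarith [hx.2, hy.1]⟩, ?_⟩
      rwa [Complex.ofReal_sub, ← add_sub_assoc]
    linarith [csInf_le hBb this, hy.1]
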